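/- **Definitions.** An \emph{abstract numeration system} is a triple $\mathcal S=(L,A,<)$ where $L$ is an infinite regular language over a finite totally ordered alphabet $(A,<)$. Words are ordered by the radix order (first by length, then lexicographically); $\mathrm{rep}_{\mathcal S}(n)$ is the $n$-th word of $L$ in this order (starting from $n=0$), and $\mathrm{val}_{\mathcal S}\colon L\to\mathbb N$ is the inverse of $\mathrm{rep}_{\mathcal S}\colon\mathbb N\to L$. Let $\boldsymbol{\mathcal S}=(\mathcal S_1,\dots,\mathcal S_d)$ be a $d$-tuple of abstract numeration systems $\mathcal S_i=(L_i,A_i,<_i)$ and let $\#$ be a symbol not in $A_1\cup\dots\cup A_d$. For words $w_i\in A_i^*$, let $(w_1,\dots,w_d)^\#$ be the word over the alphabet $$\boldsymbol A=\big((A_1\cup\{\#\})\times\dots\times(A_d\cup\{\#\})\big)\setminus\{(\#,\dots,\#)\}$$ obtained by padding each $w_i$ on the left with symbols $\#$ up to length $\max_j|w_j|$ and reading the resulting tuple letter by letter. Put $\boldsymbol L=\{(w_1,\dots,w_d)^\#: w_i\in L_i\}$ and $\mathrm{rep}_{\boldsymbol{\mathcal S}}(n_1,\dots,n_d)=(\mathrm{rep}_{\mathcal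 S_1}(n_1),\dots,\mathrm{rep}_{\mathcal S_d}(n_d))^\#$, which is a bijection $\mathbb N^d\to\boldsymbol L$ with inverse $\mathrm{val}_{\boldsymbol{\mathcal S}}$. A set $X\subseteq\mathbb N^d$ is \emph{$\boldsymbol{\mathcal S}$-recognizable} if the language $\mathrm{rep}_{\boldsymbol{\mathcal S}}(X)$ is regular. For a semiring $\mathbb K$, a series $T\colon\boldsymbol A^*\to\mathbb K$ is \emph{$\mathbb K$-recognizable} if there are $r\ge 1$, a monoid morphism $\mu\colon\boldsymbol A^*\to\mathbb K^{r\times r}$, $\lambda\in\mathbb K^{1\times r}$ and $\gamma\in\mathbb K^{r\times 1}$ with $T(w)=\lambda\,\mu(w)\,\gamma$ for all $w\in\boldsymbol A^*$. A function $f\colon\mathbb N^d\to\mathbb K$ is \emph{$(\boldsymbol{\mathcal S},\mathbb K)$-regular} if the series with value $f(\mathrm{val}_{\boldsymbol{\mathcal S}}(w))$ at each $w\in\boldsymbol L$ and $0$ at each $w\in\boldsymbol A^*\setminus\boldsymbol L$ is $\mathbb K$-recognizable. Finally, $\mathbb N_\infty=\mathbb N\cup\{\infty\}$ is the semiring with the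 usual operations and $0\cdot\infty=\infty\cdot 0=0$. **Theorem.** Let $\boldsymbol{\mathcal S}=(\mathcal S_1,\dots,\mathcal S_d)$ and $\boldsymbol{\mathcal S}'=(\mathcal S'_1,\dots,\mathcal S'_{d'})$ be tuples of abstract numeration systems, and let $X\subseteq\mathbb N^{d+d'}$ be an $(\boldsymbol{\mathcal S},\boldsymbol{\mathcal S}')$-recognizable set, where $(\boldsymbol{\mathcal S},\boldsymbol{\mathcal S}')=(\mathcal S_1,\dots,\mathcal S_d,\mathcal S'_1,\dots,\mathcal S'_{d'})$. Then the function $$f\colon\mathbb N^d\to\mathbb N_\infty,\qquad f(\boldsymbol n)=\mathrm{Card}\{\boldsymbol n'\in\mathbb N^{d'}:(\boldsymbol n,\boldsymbol n')\in X\}$$ is $(\boldsymbol{\mathcal S},\mathbb N_\infty)$-regular. If moreover $f(\mathbb N^d)\subseteq\mathbb N$, then $f$ is $(\boldsymbol{\mathcal S},\mathbb N)$-regular. -/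

import Mathlib

universe u

/-- An abstract numeration system `(L, A, <)`: an infinite regular language `L` over a finite
totally ordered alphabet `(A, <)`. -/
structure AbstractNumerationSystem where
  /-- the alphabet -/
  Letter : Type u
  [finite_letter : Finite Letter]
  [linearOrder_letter : LinearOrder Letter]
  /-- the numeration language -/
  language : Language Letter
  isRegular : language.IsRegular
  infinite : (language : Set (List Letter)).Infinite

namespace AbstractNumerationSystem

attribute [instance] finite_letter linearOrder_letter

/-- The radix (genealogical) order on words: first by length, then lexicographically. -/
def RadixLT (S : AbstractNumerationSystem.{u}) (v w : List S.Letter) : Prop :=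
  List.Shortlex (· < ·) v w

/-- The numeration language, as a set of words. -/
def words (S : AbstractNumerationSystem.{u}) : Set (List S.Letter) := S.language

/-- The value of a word: the number of words of the numeration language that precede it in the
radix order. It is meant for words of the numeration language, where it is the index (starting
from `0`) of the word in the language. -/
noncomputable def val (S : AbstractNumerationSystem.{u}) (w : List S.Letter) : ℕ :=
  {v | v ∈ S.words ∧ S.RadixLT v w}.ncard

theorem RadixLT.trans {S : AbstractNumerationSystem.{u}} {a b c : List S.Letter}
    (h : S.RadixLT a b) (h' : S.RadixLT b c) : S.RadixLT a c := by
  unfold RadixLT at *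
  rw [List.shortlex_def] at *
  rcases h with h | ⟨h, k⟩ <;> rcases h' with h' | ⟨h', k'⟩
  · exact Or.inl (h.trans h')
  · exact Or.inl (h' ▸ h)
  · exact Or.inl (h ▸ h')
  · exact Or.inr ⟨h.trans h', List.lt_trans k k'⟩

theorem RadixLT.irrefl {S : AbstractNumerationSystem.{u}} (a : List S.Letter) :
    ¬ S.RadixLT a a := fun h => Std.Asymm.asymm (r := List.Shortlex (· < ·)) a a h h

theorem RadixLT.total {S : AbstractNumerationSystem.{u}} {a b : List S.Letter} (h : a ≠ b) :
    S.RadixLT a b ∨ S.RadixLT b a := by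
  by_contra hc
  rw [not_or] at hc
  exact h (Std.Trichotomous.trichotomous (r := List.Shortlex (· < ·)) a b hc.1 hc.2)

theorem finite_radixLT (S : AbstractNumerationSystem.{u}) (w : List S.Letter) :
    {v | v ∈ S.words ∧ S.RadixLT v w}.Finite := by
  refine (List.finite_length_le S.Letter w.length).subset ?_
  rintro v ⟨-, hv⟩
  rcases List.shortlex_def.1 hv with h | ⟨h, -⟩
  · exact h.le
  · exact h.le

theorem val_lt_val (S : AbstractNumerationSystem.{u}) {v w : List S.Letter} (hv : v ∈ S.words)
    (h : S.RadixLT v w) : S.val v < S.val w := by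
  refine Set.ncard_lt_ncard ?_ (S.finite_radixLT w)
  have hsub : {x | x ∈ S.words ∧ S.RadixLT x v} ⊆ {x | x ∈ S.words ∧ S.RadixLT x w} :=
    fun x hx => ⟨hx.1, RadixLT.trans hx.2 h⟩
  rw [Set.ssubset_iff_of_subset hsub]
  exact ⟨v, ⟨hv, h⟩, fun hx => RadixLT.irrefl v hx.2⟩

/-- The value function is a bijection from the numeration language onto `ℕ`. -/
theorem val_bijective (S : AbstractNumerationSystem.{u}) :
    Function.Bijective (fun w : S.words => S.val w.1) := by
  constructor
  · rintro ⟨v, hv⟩ ⟨w, hw⟩ h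
    by_contra hne
    rcases RadixLT.total (S := S) (fun h' => hne (Subtype.ext h') : v ≠ w) with h' | h'
    · exact (S.val_lt_val hv h').ne h
    · exact (S.val_lt_val hw h').ne h.symm
  · have wf : WellFounded S.RadixLT := List.Shortlex.wf wellFounded_lt
    intro n
    induction n with
    | zero =>
      obtain ⟨w, hw, hmin⟩ := wf.has_min S.words S.infinite.nonempty
      refine ⟨⟨w, hw⟩, ?_⟩
      have : {v | v ∈ S.words ∧ S.RadixLT v w} = ∅ :=
        Set.eq_empty_iff_forall_notMem.2 fun v hv => hmin v hv.1 hv.2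
      simp [val, this]
    | succ n ih =>
      obtain ⟨⟨w, hw⟩, hn⟩ := ih
      have hne : {v | v ∈ S.words ∧ S.RadixLT w v}.Nonempty := by
        by_contra hc
        refine S.infinite (((S.finite_radixLT w).insert w).subset fun v hv => ?_)
        by_cases hvw : v = w
        · exact Or.inl hvw
        · rcases RadixLT.total hvw with h | h
          · exact Or.inr ⟨hv, h⟩
          · exact absurd ⟨v, hv, h⟩ hc
      obtain ⟨x, ⟨hx, hwx⟩, hmin⟩ := wf.has_min _ hne
      refine ⟨⟨x, hx⟩, ?_⟩
      have : {v | v ∈ S.words ∧ S.RadixLT v x} =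
          insert w {v | v ∈ S.words ∧ S.RadixLT v w} := by
        ext v
        constructor
        · rintro ⟨hv, hvx⟩
          by_cases hvw : v = w
          · exact Or.inl hvw
          · rcases RadixLT.total hvw with h | h
            · exact Or.inr ⟨hv, h⟩
            · exact absurd hvx (hmin v ⟨hv, h⟩)
        · rintro (rfl | ⟨hv, h⟩)
          · exact ⟨hw, hwx⟩
          · exact ⟨hv, h.trans hwx⟩
      have hn' : {v | v ∈ S.words ∧ S.RadixLT v w}.ncard = n := hn
      change {v | v ∈ S.words ∧ S.RadixLT v x}.ncard = n + 1
      rw [this, Set.ncard_insert_of_notMem (fun h => RadixLT.irrefl w h.2) (S.finite_radixLT w),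
        hn']

/-- The representation of `n`: the `n`-th word (starting from `0`) of the numeration language in
the radix order. It is the inverse of the value function. -/
noncomputable def rep (S : AbstractNumerationSystem.{u}) : ℕ ≃ S.words :=
  (Equiv.ofBijective _ S.val_bijective).symm

end AbstractNumerationSystem

section MultiDim

variable {d : ℕ}

/-- The `d`-dimensional padded alphabet `((A₁ ∪ {#}) × ⋯ × (A_d ∪ {#})) ∖ {(#, …, #)}`, where the
padding symbol `#` is `none`. -/
abbrev PaddedLetter (S : Fin d → AbstractNumerationSystem.{u}) : Type u :=
  {a : ∀ i, Option (S i).Letter // a ≠ fun _ => none}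

/-- The maximal length of a tuple of words. -/
def maxLength (S : Fin d → AbstractNumerationSystem.{u}) (w : ∀ i, List (S i).Letter) : ℕ :=
  Finset.univ.sup fun i => (w i).length

/-- The `i`-th word of a tuple, padded on the left with `#` up to the maximal length. -/
def padComponent (S : Fin d → AbstractNumerationSystem.{u}) (w : ∀ i, List (S i).Letter)
    (i : Fin d) : List (Option (S i).Letter) :=
  List.replicate (maxLength S w - (w i).length) none ++ (w i).map some

theorem length_padComponent (S : Fin d → AbstractNumerationSystem.{u})
    (w : ∀ i, List (S i).Letter) (i : Fin d) :
    (padComponent S w i).length = maxLength S w := by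
  have : (w i).length ≤ maxLength S w :=
    Finset.le_sup (f := fun i => (w i).length) (Finset.mem_univ i)
  simp [padComponent, this]

/-- The `j`-th column of a padded tuple of words. -/
def padColumn (S : Fin d → AbstractNumerationSystem.{u}) (w : ∀ i, List (S i).Letter)
    (j : Fin (maxLength S w)) (i : Fin d) : Option (S i).Letter :=
  (padComponent S w i)[j.1]'(by rw [length_padComponent]; exact j.2)

theorem padColumn_ne (S : Fin d → AbstractNumerationSystem.{u}) (w : ∀ i, List (S i).Letter)
    (j : Fin (maxLength S w)) : padColumn S w j ≠ fun _ => none := by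
  intro h
  obtain ⟨i, -, hi⟩ := (Finset.lt_sup_iff (s := Finset.univ)
    (f := fun i => (w i).length)).1 (lt_of_le_of_lt (Nat.zero_le _) j.2)
  have hne : (Finset.univ : Finset (Fin d)).Nonempty := ⟨i, Finset.mem_univ i⟩
  obtain ⟨k, -, hk⟩ := Finset.exists_mem_eq_sup _ hne fun i => (w i).length
  have hk' : maxLength S w = (w k).length := hk
  have := congrFun h k
  simp [padColumn, padComponent, hk'] at this

/-- The word `(w₁, …, w_d)^#` over the padded alphabet: all words are padded on the left with `#`
to the maximal length, and the result is read column by column. -/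
def pad (S : Fin d → AbstractNumerationSystem.{u}) (w : ∀ i, List (S i).Letter) :
    List (PaddedLetter S) :=
  List.ofFn fun j => ⟨padColumn S w j, padColumn_ne S w j⟩

/-- The numeration language `(L₁ × ⋯ × L_d)^#`. -/
def numerationLanguage (S : Fin d → AbstractNumerationSystem.{u}) : Set (List (PaddedLetter S)) :=
  pad S '' {w | ∀ i, w i ∈ (S i).words}

/-- The representation `(rep n₁, …, rep n_d)^#` of a vector of nonnegative integers. -/
noncomputable def repVec (S : Fin d → AbstractNumerationSystem.{u}) (n : Fin d → ℕ) :
    List (PaddedLetter S) :=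
  pad S fun i => ((S i).rep (n i)).1

/-- The value of a word over the padded alphabet: in each component, erase the symbols `#` and take
the value of the remaining word. It is meant for words of the numeration language. -/
noncomputable def valVec (S : Fin d → AbstractNumerationSystem.{u}) (w : List (PaddedLetter S))
    (i : Fin d) : ℕ :=
  (S i).val (w.filterMap fun a => a.1 i)

/-- A set of vectors is recognizable if the language of its representations is regular. -/
def IsRecognizableSet (S : Fin d → AbstractNumerationSystem.{u}) (X : Set (Fin d → ℕ)) : Prop :=
  Language.IsRegular (repVec S '' X : Language (PaddedLetter S))

/-- A series `T : A* → K` is recognizable if it has a linear representation `(l, μ, c)` of some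
dimension `r ≥ 1`. -/
def IsRecognizableSeries {A : Type*} {K : Type*} [Semiring K] (T : List A → K) : Prop :=
  ∃ r : ℕ, 1 ≤ r ∧
    ∃ (l : Matrix (Fin 1) (Fin r) K) (μ : FreeMonoid A →* Matrix (Fin r) (Fin r) K)
      (c : Matrix (Fin r) (Fin 1) K),
      ∀ w : List A, T w = (l * μ (FreeMonoid.ofList w) * c) 0 0

open Classical in
/-- The series with coefficient `f (val w)` at the words `w` of the numeration language, and `0`
at all other words. -/
noncomputable def seriesOf (S : Fin d → AbstractNumerationSystem.{u}) {K : Type*} [Semiring K]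
    (f : (Fin d → ℕ) → K) (w : List (PaddedLetter S)) : K :=
  if w ∈ numerationLanguage S then f (valVec S w) else 0

/-- A sequence `f : ℕ^d → K` is `(S, K)`-regular if its series is `K`-recognizable. -/
def IsRegularSequence (S : Fin d → AbstractNumerationSystem.{u}) {K : Type*} [Semiring K]
    (f : (Fin d → ℕ) → K) : Prop :=
  IsRecognizableSeries (seriesOf S f)

end MultiDim

namespace Set

/-! Let a DFA accept the representations of `X`, and let `p` keep the first `d` components of a
padded letter, erasing the letter if these are all `#`. Since padding is on the left, a word
representing `(n, n')` is an erased prefix followed by a letterwise lift of `rep n`. Hence `f n`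
counts the accepted words of this shape (`encard_paddedLifts_projLetter`). Splitting such words at
the state `q` reached after the prefix gives a sum over `q` of (erased words leading to `q`) ×
(accepted lifts of `rep n` from `q`), see `encard_paddedLifts`. The second factor is an entry of a
product of natural matrices applied to the accepting vector, as the alphabet is finite; so this is a
linear representation, with `∞` possible only in the initial row. If `f` is finite, a state with
infinite initial weight never has an accepted lift, and its weight may be replaced by `0`. -/

theorem encard_image2_of_injOn {α β γ : Type*} {f : α → β → γ} {s : Set α} {t : Set β}
    (h : (s ×ˢ t).InjOn fun x => f x.1 x.2) :
    (image2 f s t).encard = s.encard * t.encard := by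
  rw [← image_prod, h.encard_image, encard_prod]

end Set

/-! ### Counting accepted words above a given word. -/

namespace DFA

variable {α β σ : Type*} (M : DFA β σ) (p : β → Option α)

/-- The words read letter by letter as `v` by the partial letter map `p` and accepted from `q`. -/
def liftsFrom (v : List α) (q : σ) : Set (List β) :=
  {y | y.map p = v.map some ∧ M.evalFrom q y ∈ M.accept}

/-- The words all of whose letters are erased by `p` and which lead from the start state to `q`. -/
def erasedTo (q : σ) : Set (List β) :=
  {x | (∃ k, x.map p = List.replicate k none) ∧ M.eval x = q}

/-- The accepted words read as `v` by the partial letter map `p`, where `p` erases letters only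
at the beginning of the word. -/
def paddedLifts (v : List α) : Set (List β) :=
  {x | x ∈ M.accepts ∧ ∃ k, x.map p = List.replicate k none ++ v.map some}

/-- The letters over `a` that lead from `q` to `q'`. -/
def lettersOver (a : α) (q q' : σ) : Set β :=
  {b | p b = some a ∧ M.step q b = q'}

theorem liftsFrom_cons (a : α) (v : List α) (q : σ) :
    M.liftsFrom p (a :: v) q =
      ⋃ q', Set.image2 List.cons (M.lettersOver p a q q') (M.liftsFrom p v q') := by
  ext y
  simp only [liftsFrom, lettersOver, Set.mem_iUnion, Set.mem_image2, Set.mem_ofPred_eq]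
  constructor
  · rintro ⟨h, hy⟩
    cases y with
    | nil => simp at h
    | cons b y =>
      simp only [List.map_cons, List.cons.injEq] at h
      exact ⟨_, b, ⟨h.1, rfl⟩, y, ⟨h.2, hy⟩, rfl⟩
  · rintro ⟨q', b, ⟨hb, rfl⟩, y, ⟨h, hy⟩, rfl⟩
    exact ⟨by simp [hb, h], hy⟩

theorem paddedLifts_eq_iUnion (v : List α) :
    M.paddedLifts p v =
      ⋃ q, Set.image2 (· ++ ·) (M.erasedTo p q) (M.liftsFrom p v q) := by
  ext x
  simp only [paddedLifts, liftsFrom, erasedTo, Set.mem_iUnion, Set.mem_image2, Set.mem_ofPred_eq]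
  constructor
  · rintro ⟨hx, k, h⟩
    obtain ⟨u, y, rfl, hu, hy⟩ := List.map_eq_append_iff.1 h
    refine ⟨_, u, ⟨⟨k, hu⟩, rfl⟩, y, ⟨hy, ?_⟩, rfl⟩
    rw [eval, ← evalFrom_of_append]
    exact hx
  · rintro ⟨q, u, ⟨⟨k, hu⟩, rfl⟩, y, ⟨hy, hacc⟩, rfl⟩
    refine ⟨?_, k, by simp [hu, hy]⟩
    rw [mem_accepts, eval, evalFrom_of_append]
    exact hacc

variable [Fintype σ]

theorem encard_liftsFrom_cons (a : α) (v : List α) (q : σ) :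
    (M.liftsFrom p (a :: v) q).encard =
      ∑ q', (M.lettersOver p a q q').encard * (M.liftsFrom p v q').encard := by
  rw [liftsFrom_cons, Set.encard_iUnion_of_finite, finsum_eq_sum_of_fintype]
  · refine Finset.sum_congr rfl fun q' _ => Set.encard_image2_of_injOn ?_
    rintro ⟨b, y⟩ - ⟨b', y'⟩ - h
    simpa using h
  · intro q₁ q₂ hne
    refine Set.disjoint_left.2 ?_
    rintro _ ⟨b, hb, y, -, rfl⟩ ⟨b', hb', y', -, h⟩
    obtain ⟨rfl, rfl⟩ := List.cons.inj h
    -- Determinism: the letter read fixes the next state.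
    exact hne (hb.2.symm.trans hb'.2)

/-- The lifted part has the length of `v`, so the cut point is unique; determinism then fixes the
intermediate state, and the union is disjoint. -/
theorem encard_paddedLifts (v : List α) :
    (M.paddedLifts p v).encard =
      ∑ q, (M.erasedTo p q).encard * (M.liftsFrom p v q).encard := by
  have key : ∀ {u u' y y' : List β} {q q' : σ}, y ∈ M.liftsFrom p v q →
      y' ∈ M.liftsFrom p v q' → u ++ y = u' ++ y' → u = u' ∧ y = y' := by
    intro u u' y y' q q' hy hy' h
    refine List.append_inj' h ?_
    have h₁ := congrArg List.length hy.1
    have h₂ := congrArg List.length hy'.1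
    simp only [List.length_map] at h₁ h₂
    rw [h₁, h₂]
  rw [paddedLifts_eq_iUnion, Set.encard_iUnion_of_finite, finsum_eq_sum_of_fintype]
  · refine Finset.sum_congr rfl fun q' _ => Set.encard_image2_of_injOn ?_
    rintro ⟨u, y⟩ hu ⟨u', y'⟩ hu' h
    obtain ⟨rfl, rfl⟩ := key hu.2 hu'.2 h
    rfl
  · intro q₁ q₂ hne
    refine Set.disjoint_left.2 ?_
    rintro _ ⟨u, hu, y, hy, rfl⟩ ⟨u', hu', y', hy', h⟩
    obtain ⟨rfl, rfl⟩ := key hy' hy h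
    exact hne (hu.2.symm.trans hu'.2)

/-- The matrix counting the letters over `a` between two states. -/
noncomputable def letterMatrix (a : α) : Matrix σ σ ℕ :=
  Matrix.of fun q q' => (M.lettersOver p a q q').ncard

open Classical in
/-- The characteristic vector of the accepting states. -/
noncomputable def acceptVec : σ → ℕ := fun q => if q ∈ M.accept then 1 else 0

variable [DecidableEq σ]

/-- Finiteness of `β` makes each matrix entry, an `ncard`, a genuine cardinality; hence lifts from a
state are always finitely many. -/
theorem coe_prod_letterMatrix_mulVec [Finite β] (v : List α) (q : σ) :
    ((((v.map (M.letterMatrix p)).prod.mulVec M.acceptVec) q : ℕ) : ℕ∞) =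
      (M.liftsFrom p v q).encard := by
  induction v generalizing q with
  | nil =>
    have hset : M.liftsFrom p [] q = {y | y = [] ∧ q ∈ M.accept} := by
      ext y
      simp only [liftsFrom, List.map_nil, List.map_eq_nil_iff, Set.mem_ofPred_eq]
      exact and_congr_right fun h => by rw [h, evalFrom_nil]
    by_cases hq : q ∈ M.accept <;> simp [hset, hq, acceptVec]
  | cons a v ih =>
    rw [encard_liftsFrom_cons, List.map_cons, List.prod_cons, ← Matrix.mulVec_mulVec,
      Matrix.mulVec, dotProduct, Nat.cast_sum]
    refine Finset.sum_congr rfl fun q' _ => ?_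
    rw [Nat.cast_mul, ih]
    simp only [letterMatrix, Matrix.of_apply]
    rw [(Set.toFinite (M.lettersOver p a q q')).cast_ncard_eq]

end DFA

/-- A series given by a linear representation indexed by a finite nonempty type is recognizable. -/
theorem IsRecognizableSeries.of_fintype {A K σ : Type*} [Semiring K] [Fintype σ] [DecidableEq σ]
    [Nonempty σ] {T : List A → K} (l : σ → K) (N : A → Matrix σ σ K) (c : σ → K)
    (h : ∀ w, T w = l ⬝ᵥ (w.map N).prod.mulVec c) : IsRecognizableSeries T := by
  let e := Fintype.equivFin σ
  refine ⟨Fintype.card σ, Fintype.card_pos, Matrix.of fun _ i => l (e.symm i),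
    FreeMonoid.lift fun a => (N a).submatrix e.symm e.symm,
    Matrix.of fun i _ => c (e.symm i), fun w => ?_⟩
  have hprod : FreeMonoid.lift (fun a => (N a).submatrix e.symm e.symm) (FreeMonoid.ofList w) =
      (w.map N).prod.submatrix e.symm e.symm := by
    rw [FreeMonoid.lift_apply, FreeMonoid.toList_ofList]
    induction w with
    | nil => simp
    | cons a w ih => simp [ih, Matrix.submatrix_mul_equiv]
  rw [h, hprod, Matrix.mul_assoc, Matrix.mul_apply, dotProduct, ← Equiv.sum_comp e.symm]
  refine Finset.sum_congr rfl fun i _ => ?_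
  rw [Matrix.mul_apply, Matrix.mulVec, dotProduct, ← Equiv.sum_comp e.symm]
  rfl

/-! ### Linear representations of the counting series. -/

namespace DFA

variable {α β σ : Type*} [Finite β] [Fintype σ] (M : DFA β σ) (p : β → Option α)

theorem isRecognizableSeries_encard_paddedLifts :
    IsRecognizableSeries fun v => (M.paddedLifts p v).encard := by
  classical
  have : Nonempty σ := ⟨M.start⟩
  refine .of_fintype (fun q => (M.erasedTo p q).encard)
    (fun a => (M.letterMatrix p a).map (Nat.castRingHom ℕ∞))
    (fun q => (M.acceptVec q : ℕ∞)) fun v => ?_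
  rw [encard_paddedLifts, dotProduct]
  refine Finset.sum_congr rfl fun q _ => ?_
  have hprod : (v.map fun a => (M.letterMatrix p a).map (Nat.castRingHom ℕ∞)).prod =
      (v.map (M.letterMatrix p)).prod.map (Nat.castRingHom ℕ∞) := by
    have := map_list_prod (Nat.castRingHom ℕ∞).mapMatrix (v.map (M.letterMatrix p))
    rw [List.map_map] at this
    exact this.symm
  rw [← coe_prod_letterMatrix_mulVec, hprod, Matrix.mulVec, Matrix.mulVec, dotProduct, dotProduct]
  simp

theorem isRecognizableSeries_of_encard_paddedLifts {T : List α → ℕ}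
    (hT : ∀ v, (M.paddedLifts p v).encard = T v) : IsRecognizableSeries T := by
  classical
  have : Nonempty σ := ⟨M.start⟩
  -- `toNat` sends `⊤` to `0`, which is the weight wanted for states with infinitely many erased
  -- words.
  refine .of_fintype (fun q => (M.erasedTo p q).encard.toNat) (M.letterMatrix p) M.acceptVec
    fun v => ?_
  have hT' := hT v
  have hne : ∀ q, (M.erasedTo p q).encard * (M.liftsFrom p v q).encard ≠ ⊤ := fun q htop => by
    have hle : (M.erasedTo p q).encard * (M.liftsFrom p v q).encard ≤ T v := by
      rw [← hT', encard_paddedLifts]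
      exact Finset.single_le_sum
        (f := fun q => (M.erasedTo p q).encard * (M.liftsFrom p v q).encard)
        (fun _ _ => zero_le) (Finset.mem_univ q)
    rw [htop, top_le_iff] at hle
    exact ENat.natCast_ne_top _ hle
  rw [← ENat.natCast_inj, ← hT', encard_paddedLifts, dotProduct, Nat.cast_sum]
  refine Finset.sum_congr rfl fun q _ => ?_
  rw [Nat.cast_mul, coe_prod_letterMatrix_mulVec]
  by_cases h : (M.erasedTo p q).encard = ⊤
  · have h0 : (M.liftsFrom p v q).encard = 0 := by
      by_contra h0
      exact hne q (by rw [h, ENat.top_mul h0])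
    rw [h0, mul_zero, mul_zero]
  · rw [ENat.natCast_toNat h]

end DFA

/-! ### Padded representations and their inverse. -/

section Padding

variable {d : ℕ} (S : Fin d → AbstractNumerationSystem.{u})

theorem length_le_maxLength (w : ∀ i, List (S i).Letter) (i : Fin d) :
    (w i).length ≤ maxLength S w :=
  Finset.le_sup (f := fun i => (w i).length) (Finset.mem_univ i)

theorem length_pad (w : ∀ i, List (S i).Letter) : (pad S w).length = maxLength S w := by
  simp [pad]

theorem map_pad_component (w : ∀ i, List (S i).Letter) (i : Fin d) :
    (pad S w).map (fun a => a.1 i) = padComponent S w i := by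
  refine List.ext_getElem ?_ fun j h₁ h₂ => ?_
  · rw [List.length_map, length_pad, length_padComponent]
  · simp [pad, padColumn]

theorem filterMap_pad (w : ∀ i, List (S i).Letter) (i : Fin d) :
    (pad S w).filterMap (fun a => a.1 i) = w i := by
  have h : (pad S w).filterMap (fun a => a.1 i) =
      ((pad S w).map fun a => a.1 i).filterMap id := by
    rw [List.filterMap_map]
    rfl
  rw [h, map_pad_component, padComponent, List.filterMap_append, List.filterMap_map]
  simp

theorem AbstractNumerationSystem.val_rep (S : AbstractNumerationSystem.{u}) (n : ℕ) :
    S.val (S.rep n).1 = n :=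
  (Equiv.ofBijective _ S.val_bijective).apply_symm_apply n

theorem AbstractNumerationSystem.rep_val (S : AbstractNumerationSystem.{u}) {w : List S.Letter}
    (hw : w ∈ S.words) : (S.rep (S.val w)).1 = w :=
  congrArg Subtype.val ((Equiv.ofBijective _ S.val_bijective).symm_apply_apply ⟨w, hw⟩)

theorem valVec_repVec (n : Fin d → ℕ) : valVec S (repVec S n) = n := by
  funext i
  rw [valVec, repVec, filterMap_pad, AbstractNumerationSystem.val_rep]

theorem repVec_injective : Function.Injective (repVec S) :=
  Function.LeftInverse.injective (valVec_repVec S)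

theorem repVec_mem_numerationLanguage (n : Fin d → ℕ) : repVec S n ∈ numerationLanguage S :=
  ⟨_, fun i => ((S i).rep (n i)).2, rfl⟩

theorem repVec_valVec {v : List (PaddedLetter S)} (hv : v ∈ numerationLanguage S) :
    repVec S (valVec S v) = v := by
  obtain ⟨w, hw, rfl⟩ := hv
  rw [repVec]
  congr 1
  funext i
  rw [valVec, filterMap_pad, AbstractNumerationSystem.rep_val _ (hw i)]

end Padding

/-! ### Projecting padded words to selected components. -/

section Projection

variable {D d : ℕ} (R : Fin D → AbstractNumerationSystem.{u}) (e : Fin d → Fin D)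

open Classical in
/-- The projection of a padded letter to the components selected by `e`; it is `none` if all of
these components are padding symbols. -/
noncomputable def projLetter (b : PaddedLetter R) : Option (PaddedLetter fun i => R (e i)) :=
  if h : (fun i => b.1 (e i)) = fun _ => none then none else some ⟨_, h⟩

theorem maxLength_comp_le (w : ∀ i, List (R i).Letter) :
    maxLength (fun i => R (e i)) (fun i => w (e i)) ≤ maxLength R w :=
  Finset.sup_le fun i _ => length_le_maxLength R w (e i)

theorem padComponent_comp (w : ∀ i, List (R i).Letter) (i : Fin d) :
    padComponent R w (e i) =
      List.replicate (maxLength R w - maxLength (fun i => R (e i)) fun i => w (e i)) none ++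
        padComponent (fun i => R (e i)) (fun i => w (e i)) i := by
  have h₁ := maxLength_comp_le R e w
  have h₂ := length_le_maxLength (fun i => R (e i)) (fun i => w (e i)) i
  rw [padComponent, padComponent, ← List.append_assoc, List.replicate_append_replicate]
  congr 2
  omega

/-- Words are aligned on the right, so restricting the components blanks only leading columns; from
the length of the longest selected word onwards, each column keeps a proper letter. -/
theorem map_projLetter_pad (w : ∀ i, List (R i).Letter) :
    (pad R w).map (projLetter R e) =
      List.replicate (maxLength R w - maxLength (fun i => R (e i)) fun i => w (e i)) none ++
        (pad (fun i => R (e i)) fun i => w (e i)).map some := by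
  have hle := maxLength_comp_le R e w
  refine List.ext_getElem ?_ fun j h₁ h₂ => ?_
  · simp only [List.length_map, length_pad, List.length_append, List.length_replicate]
    omega
  · have hj : j < maxLength R w := by simpa [length_pad] using h₁
    by_cases hlt : j < maxLength R w - maxLength (fun i => R (e i)) fun i => w (e i)
    · rw [List.getElem_append_left (by simpa using hlt), List.getElem_map,
        List.getElem_replicate, projLetter, dif_pos]
      funext i
      simp only [pad, List.getElem_ofFn, padColumn, padComponent_comp R e w i]
      rw [List.getElem_append_left (by simpa using hlt), List.getElem_replicate]
    · have hcol : (fun i => ((pad R w)[j]'(by rwa [length_pad])).1 (e i)) =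
          padColumn (fun i => R (e i)) (fun i => w (e i))
            ⟨j - (maxLength R w - maxLength (fun i => R (e i)) fun i => w (e i)), by omega⟩ := by
        funext i
        simp only [pad, List.getElem_ofFn, padColumn, padComponent_comp R e w i]
        rw [List.getElem_append_right (by simpa using hlt)]
        simp
      rw [List.getElem_append_right (by simpa using hlt), List.getElem_map, projLetter, dif_neg]
      · simp only [hcol]
        simp [pad]
      · rw [hcol]
        exact padColumn_ne _ _ _

theorem exists_map_projLetter_repVec_iff (m : Fin D → ℕ)
    (v : List (PaddedLetter fun i => R (e i))) :
    (∃ k, (repVec R m).map (projLetter R e) = List.replicate k none ++ v.map some) ↔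
      repVec (fun i => R (e i)) (fun i => m (e i)) = v := by
  constructor
  · rintro ⟨k, h⟩
    rw [repVec, map_projLetter_pad] at h
    -- Dropping every `none` recovers both words whatever the two prefix lengths are.
    have := congrArg (List.filterMap id) h
    simpa [repVec, List.filterMap_append, List.filterMap_map] using this
  · rintro rfl
    exact ⟨_, map_projLetter_pad R e _⟩

theorem encard_paddedLifts_projLetter {σ : Type*} [Fintype σ] (M : DFA (PaddedLetter R) σ)
    {X : Set (Fin D → ℕ)} (hM : M.accepts = (repVec R '' X : Set (List (PaddedLetter R))))
    (v : List (PaddedLetter fun i => R (e i))) :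
    (M.paddedLifts (projLetter R e) v).encard =
      {m | m ∈ X ∧ repVec (fun i => R (e i)) (fun i => m (e i)) = v}.encard := by
  rw [← (repVec_injective R).encard_image]
  congr 1
  ext x
  have hx : x ∈ M.accepts ↔ x ∈ repVec R '' X := by rw [hM]; rfl
  simp only [DFA.paddedLifts, hx, Set.mem_ofPred_eq, Set.mem_image]
  constructor
  · rintro ⟨⟨m, hm, rfl⟩, h⟩
    exact ⟨m, ⟨hm, (exists_map_projLetter_repVec_iff R e m v).1 h⟩, rfl⟩
  · rintro ⟨m, ⟨hm, h⟩, rfl⟩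
    exact ⟨⟨m, hm, rfl⟩, (exists_map_projLetter_repVec_iff R e m v).2 h⟩

end Projection

/-! ### Cardinalities of fibres over the selected components. -/

section Fibers

variable {D d : ℕ} (R : Fin D → AbstractNumerationSystem.{u}) (e : Fin d → Fin D)

theorem encard_repVec_eq_seriesOf (X : Set (Fin D → ℕ))
    (v : List (PaddedLetter fun i => R (e i))) :
    {m | m ∈ X ∧ repVec (fun i => R (e i)) (fun i => m (e i)) = v}.encard =
      seriesOf (fun i => R (e i)) (fun n => {m | m ∈ X ∧ (fun i => m (e i)) = n}.encard) v := by
  rw [seriesOf]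
  split_ifs with hv
  · congr 1
    ext m
    refine and_congr_right fun _ => ⟨?_, fun h => ?_⟩
    · rintro rfl
      rw [valVec_repVec]
    · rw [h, repVec_valVec _ hv]
  · rw [Set.encard_eq_zero, Set.eq_empty_iff_forall_notMem]
    rintro m ⟨-, rfl⟩
    exact hv (repVec_mem_numerationLanguage _ _)

theorem isRegularSequence_encard_fiber {X : Set (Fin D → ℕ)} (hX : IsRecognizableSet R X) :
    IsRegularSequence (fun i => R (e i)) (K := ℕ∞)
        (fun n => {m | m ∈ X ∧ (fun i => m (e i)) = n}.encard) ∧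
      ∀ g : (Fin d → ℕ) → ℕ, (∀ n, {m | m ∈ X ∧ (fun i => m (e i)) = n}.encard = (g n : ℕ∞)) →
        IsRegularSequence (fun i => R (e i)) (K := ℕ) g := by
  obtain ⟨σ, _, M, hM⟩ := hX
  have hcount : ∀ v, (M.paddedLifts (projLetter R e) v).encard =
      seriesOf (fun i => R (e i)) (fun n => {m | m ∈ X ∧ (fun i => m (e i)) = n}.encard) v :=
    fun v => by
      rw [encard_paddedLifts_projLetter R e M hM, encard_repVec_eq_seriesOf]
  refine ⟨?_, fun g hg => M.isRecognizableSeries_of_encard_paddedLifts (projLetter R e) fun v => ?_⟩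
  · have := M.isRecognizableSeries_encard_paddedLifts (projLetter R e)
    rwa [funext hcount] at this
  · rw [hcount, seriesOf, seriesOf]
    split_ifs
    · exact hg _
    · rfl

end Fibers

theorem encard_append_mem {d d' : ℕ} (X : Set (Fin (d + d') → ℕ)) (n : Fin d → ℕ) :
    {n' : Fin d' → ℕ | Fin.append n n' ∈ X}.encard =
      {m | m ∈ X ∧ (fun i => m (Fin.castAdd d' i)) = n}.encard := by
  have hinj : Function.Injective (Fin.append n : (Fin d' → ℕ) → _) := fun a b h => by
    funext j
    simpa using congrFun h (Fin.natAdd d j)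
  rw [← hinj.encard_image]
  congr 1
  ext m
  constructor
  · rintro ⟨n', hn', rfl⟩
    exact ⟨hn', by simp⟩
  · rintro ⟨hm, rfl⟩
    refine ⟨fun j => m (Fin.natAdd d j), ?_, Fin.append_castAdd_natAdd⟩
    rw [Set.mem_ofPred_eq, Fin.append_castAdd_natAdd]
    exact hm

theorem mainTheorem6 (d d' : ℕ) (S : Fin d → AbstractNumerationSystem.{u})
    (S' : Fin d' → AbstractNumerationSystem.{u}) (X : Set (Fin (d + d') → ℕ))
    (hX : IsRecognizableSet (Fin.append S S') X) :
    IsRegularSequence S (K := ℕ∞)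
        (fun n : Fin d → ℕ => {n' : Fin d' → ℕ | Fin.append n n' ∈ X}.encard) ∧
      ∀ g : (Fin d → ℕ) → ℕ,
        (∀ n : Fin d → ℕ, {n' : Fin d' → ℕ | Fin.append n n' ∈ X}.encard = (g n : ℕ∞)) →
          IsRegularSequence S (K := ℕ) g := by
  -- `S` equals the restriction of `Fin.append S S'` only propositionally; replacing `S` by a
  -- restriction of `R` avoids transport along the dependent alphabets.
  obtain ⟨R, rfl, hR⟩ : ∃ R : Fin (d + d') → AbstractNumerationSystem.{u},
      (fun i => R (Fin.castAdd d' i)) = S ∧ R = Fin.append S S' :=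
    ⟨Fin.append S S', by simp, rfl⟩
  rw [← hR] at hX
  simp only [encard_append_mem]
  exact isRegularSequence_encard_fiber R (Fin.castAdd d') hX
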